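/- Let $\mathscr H$ and $\mathfrak h$ be complex Hilbert spaces, let $A:\mathscr D(A)\subseteq\mathscr H\to\mathscr H$ be self-adjoint, and let $\tau:\mathscr D(A)\to\mathfrak h$ be linear, surjective and bounded with respect to the graph norm of $A$, with $\mathscr N:=\ker\tau$ dense in $\mathscr H$. Let $S$ be the restriction of $A$ to $\mathscr N$. For $z$ in the resolvent set $\rho(A)$ put $R(z):=(-A+z)^{-1}$ and $G(z):=(\tau R(\bar z))^*:\mathfrak h\to\mathscr H$. Consider families $\Gamma(z)$, $z\in\rho(A)$, of bounded operators in $\mathfrak h$ such that $$\Gamma(z)-\Gamma(w)=(z-w)\,G(\bar w)^*G(z),\qquad \Gamma(z)^*=\Gamma(\bar z)\qquad(z,w\in\rho(A)).$$ Such families exist; one of them is $\hat\Gamma(z):=\tau\big(\tfrac12(G(i)+G(-i))-G(z)\big)$. Let $p:\mathsf E(\mathfrak h)\to\mathsf P(\mathfrak h)$, $p(\Pi,\Theta)=\Pi$, be the bundle over the set $\mathsf P(\mathfrak h)$ of orthogonal projections in $\mathfrak h$ whose fibre $p^{-1}(\Pi)$ is the set of (possibly unbounded) self-adjoint operators $\Theta$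 in the Hilbert space $\mathscr R(\Pi)$. Fix a family $\Gamma$ as above. For $(\Pi,\Theta)\in\mathsf E(\mathfrak h)$ let $\Gamma_{\Pi,\Theta}(z):=\Theta+\Pi\Gamma(z)\Pi$, with domain $\mathscr D(\Theta)$, in $\mathscr R(\Pi)$, and let $Z_{\Pi,\Theta}:=\{z\in\rho(A):0\in\rho(\Gamma_{\Pi,\Theta}(z))\}$. Then $\mathbb C\setminus\mathbb R\subseteq Z_{\Pi,\Theta}$, and for $z\in Z_{\Pi,\Theta}$ the formulas $$\mathscr D(A_{\Pi,\Theta})=\{\phi=\phi_z+G(z)\Pi\,\Gamma_{\Pi,\Theta}(z)^{-1}\Pi\tau\phi_z:\ \phi_z\in\mathscr D(A)\},\qquad(-A_{\Pi,\Theta}+z)\phi=(-A+z)\phi_z$$ define a linear operator $A_{\Pi,\Theta}$ in $\mathscr H$ which does not depend on $z$. Moreover: 1. $\{A_{\Pi,\Theta}:(\Pi,\Theta)\in\mathsf E(\mathfrak h)\}$ is the set of all self-adjoint extensions of $S$, and $(\Pi,\Theta)\mapsto A_{\Pi,\Theta}$ is injective; thus $\mathsf E(\mathfrak h)$ parametrises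 the self-adjoint extensions of $S$. 2. The fibre $p^{-1}(\mathsf 1)$, i.e. the set of self-adjoint operators in $\mathfrak h$, parametrises exactly the relatively prime extensions: $\{A_{\mathsf 1,\Theta}\}$ is the set of all self-adjoint extensions $B$ of $S$ with $\mathscr D(B)\cap\mathscr D(A)=\mathscr N$, and for $(\Pi,\Theta)\in\mathsf E(\mathfrak h)$ one has $\mathscr D(A_{\Pi,\Theta})\cap\mathscr D(A)=\mathscr N$ if and only if $\Pi=\mathsf 1$. -/

import Mathlib

open Complex ComplexConjugate

noncomputable section

/-! ### Resolvents of unbounded operators -/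

section Resolvent

variable {E : Type*} [NormedAddCommGroup E] [InnerProductSpace ℂ E]

/-- `R` is an everywhere defined bounded inverse of the partially defined operator `T`:
`R y = x` holds exactly when `x ∈ D(T)` and `T x = y`. -/
def IsBoundedInverse (T : E →ₗ.[ℂ] E) (R : E →L[ℂ] E) : Prop :=
  ∀ x y : E, R y = x ↔ ∃ h : x ∈ T.domain, T ⟨x, h⟩ = y

open Classical in
/-- The bounded inverse `T⁻¹` (and `0` if `T` has none). -/
def boundedInverse (T : E →ₗ.[ℂ] E) : E →L[ℂ] E :=
  if h : ∃ R, IsBoundedInverse T R then h.choose else 0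

/-- The operator `-T + z` with domain `D(T)`. -/
def shifted (T : E →ₗ.[ℂ] E) (z : ℂ) : E →ₗ.[ℂ] E :=
  (z • (LinearMap.id : E →ₗ[ℂ] E)) +ᵥ (-T)

/-- The resolvent set `ρ(T)`. -/
def resolventSetOf (T : E →ₗ.[ℂ] E) : Set ℂ :=
  {z | ∃ R, IsBoundedInverse (shifted T z) R}

/-- The resolvent `R(z) = (-T + z)⁻¹`, for `z ∈ ρ(T)`. -/
def resolventOf (T : E →ₗ.[ℂ] E) (z : ℂ) : E →L[ℂ] E :=
  boundedInverse (shifted T z)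

theorem isBoundedInverse_resolventOf {T : E →ₗ.[ℂ] E} {z : ℂ} (hz : z ∈ resolventSetOf T) :
    IsBoundedInverse (shifted T z) (resolventOf T z) := by
  have h : ∃ R, IsBoundedInverse (shifted T z) R := hz
  unfold resolventOf boundedInverse
  rw [dif_pos h]
  exact h.choose_spec

theorem resolventOf_mem {T : E →ₗ.[ℂ] E} {z : ℂ} (hz : z ∈ resolventSetOf T) (ψ : E) :
    resolventOf T z ψ ∈ T.domain :=
  ((isBoundedInverse_resolventOf hz _ ψ).1 rfl).1

theorem apply_resolventOf {T : E →ₗ.[ℂ] E} {z : ℂ} (hz : z ∈ resolventSetOf T) (ψ : E) :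
    T ⟨resolventOf T z ψ, resolventOf_mem hz ψ⟩ = z • resolventOf T z ψ - ψ := by
  obtain ⟨h, h'⟩ := (isBoundedInverse_resolventOf hz _ ψ).1 rfl
  have h2 : z • resolventOf T z ψ - T ⟨resolventOf T z ψ, resolventOf_mem hz ψ⟩ = ψ := by
    rw [sub_eq_add_neg]
    exact h'
  exact eq_sub_of_add_eq (by rw [add_comm]; exact (sub_eq_iff_eq_add.1 h2).symm)

/-- The resolvent, viewed as a linear map into the operator domain. -/
def resolventToDomain (T : E →ₗ.[ℂ] E) {z : ℂ} (hz : z ∈ resolventSetOf T) :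
    E →ₗ[ℂ] T.domain :=
  (resolventOf T z : E →ₗ[ℂ] E).codRestrict T.domain (resolventOf_mem hz)

end Resolvent

/-! ### The bundle of pairs `(Π, Θ)` -/

section Bundle

variable (𝔥 : Type*) [NormedAddCommGroup 𝔥] [InnerProductSpace ℂ 𝔥] [CompleteSpace 𝔥]

/-- The set `P(𝔥)` of orthogonal projections in `𝔥`. -/
def OrthProj : Type _ := {P : 𝔥 →L[ℂ] 𝔥 // IsStarProjection P}

variable {𝔥}

/-- The identity, as an orthogonal projection. -/
def OrthProj.id : OrthProj 𝔥 := ⟨1, IsStarProjection.one _⟩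

/-- The range `𝔥₀` of an orthogonal projection, a Hilbert space with the inner product of `𝔥`. -/
abbrev OrthProj.space (P : OrthProj 𝔥) : Submodule ℂ 𝔥 := P.1.range

instance OrthProj.completeSpace (P : OrthProj 𝔥) : CompleteSpace P.space :=
  (ContinuousLinearMap.IsIdempotentElem.isClosed_range P.2.isIdempotentElem).completeSpace_coe

/-- The projection as a bounded operator of `𝔥` onto its range `𝔥₀`. -/
def OrthProj.onto (P : OrthProj 𝔥) : 𝔥 →L[ℂ] P.space := P.1.rangeRestrict

/-- The compression `Π B Π` of a bounded operator `B`, as an operator in the range of `Π`. -/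
def OrthProj.compress (P : OrthProj 𝔥) (B : 𝔥 →L[ℂ] 𝔥) : P.space →L[ℂ] P.space :=
  P.onto ∘L B ∘L P.space.subtypeL

variable (𝔥)

/-- The total space `E(𝔥)`: pairs `(Π, Θ)` of an orthogonal projection `Π` in `𝔥` and a (possibly
unbounded) self-adjoint operator `Θ` in the range of `Π`. The bundle projection `p : E(𝔥) → P(𝔥)`
is `Sigma.fst`. -/
def PairBundle : Type _ :=
  Σ P : OrthProj 𝔥, {Θ : P.space →ₗ.[ℂ] P.space // IsSelfAdjoint Θ}

variable {𝔥}

/-- The bundle projection `p (Π, Θ) = Π`. -/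
def PairBundle.proj (x : PairBundle 𝔥) : OrthProj 𝔥 := x.1

end Bundle

/-! ### The setting -/

/-- The data: a self-adjoint operator `A` in the Hilbert space `H` and a surjective linear map
`τ : D(A) → 𝔥` onto a Hilbert space, bounded for the graph norm of `A`, whose kernel is
dense in `H`. -/
structure TraceSetup (H 𝔥 : Type*)
    [NormedAddCommGroup H] [InnerProductSpace ℂ H] [CompleteSpace H]
    [NormedAddCommGroup 𝔥] [InnerProductSpace ℂ 𝔥] [CompleteSpace 𝔥] where
  A : H →ₗ.[ℂ] H
  selfAdjoint : IsSelfAdjoint A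
  τ : A.domain →ₗ[ℂ] 𝔥
  bounded : ∃ C : ℝ, ∀ φ : A.domain, ‖τ φ‖ ≤ C * √(‖A φ‖ ^ 2 + ‖(φ : H)‖ ^ 2)
  surjective : Function.Surjective τ
  dense_ker : Dense (((LinearMap.ker τ).map A.domain.subtype : Submodule ℂ H) : Set H)

namespace TraceSetup

variable {H 𝔥 : Type*}
  [NormedAddCommGroup H] [InnerProductSpace ℂ H] [CompleteSpace H]
  [NormedAddCommGroup 𝔥] [InnerProductSpace ℂ 𝔥] [CompleteSpace 𝔥]
  (D : TraceSetup H 𝔥)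

/-- The subspace `N = Ker τ` of `H`. -/
def N : Submodule ℂ H := (LinearMap.ker D.τ).map D.A.domain.subtype

/-- The symmetric operator `S`: the restriction of `A` to `N`. -/
def S : H →ₗ.[ℂ] H := D.A.domRestrict D.N

/-- `B` is a self-adjoint extension of `S`. -/
def IsSelfAdjointExtension (B : H →ₗ.[ℂ] H) : Prop := IsSelfAdjoint B ∧ D.S ≤ B

/-- `B` is relatively prime (with respect to `A`): `D(B) ∩ D(A) = N`. -/
def IsRelativelyPrime (B : H →ₗ.[ℂ] H) : Prop := B.domain ⊓ D.A.domain = D.N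

theorem exists_bound_trace_resolvent {z : ℂ} (hz : z ∈ resolventSetOf D.A) :
    ∃ C : ℝ, ∀ ψ : H, ‖(D.τ ∘ₗ resolventToDomain D.A hz) ψ‖ ≤ C * ‖ψ‖ := by
  obtain ⟨C, hC⟩ := D.bounded
  refine ⟨|C| * ((‖z‖ * ‖resolventOf D.A z‖ + 1) + ‖resolventOf D.A z‖), fun ψ => ?_⟩
  have h1 : ‖resolventOf D.A z ψ‖ ≤ ‖resolventOf D.A z‖ * ‖ψ‖ :=
    (resolventOf D.A z).le_opNorm ψ
  have h2 : ‖D.A (resolventToDomain D.A hz ψ)‖ ≤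
      ‖z‖ * (‖resolventOf D.A z‖ * ‖ψ‖) + ‖ψ‖ := by
    have : D.A (resolventToDomain D.A hz ψ) = z • resolventOf D.A z ψ - ψ :=
      apply_resolventOf hz ψ
    rw [this]
    refine (norm_sub_le _ _).trans ?_
    rw [norm_smul]
    gcongr
  have h3 : √(‖D.A (resolventToDomain D.A hz ψ)‖ ^ 2 +
      ‖(resolventToDomain D.A hz ψ : H)‖ ^ 2) ≤
      ‖D.A (resolventToDomain D.A hz ψ)‖ + ‖(resolventToDomain D.A hz ψ : H)‖ := by
    apply Real.sqrt_le_iff.2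
    refine ⟨by positivity, ?_⟩
    nlinarith [norm_nonneg (D.A (resolventToDomain D.A hz ψ)),
      norm_nonneg (resolventToDomain D.A hz ψ : H),
      mul_nonneg (norm_nonneg (D.A (resolventToDomain D.A hz ψ)))
        (norm_nonneg (resolventToDomain D.A hz ψ : H))]
  have h4 : ‖(resolventToDomain D.A hz ψ : H)‖ ≤ ‖resolventOf D.A z‖ * ‖ψ‖ := h1
  calc ‖(D.τ ∘ₗ resolventToDomain D.A hz) ψ‖
      ≤ C * √(‖D.A (resolventToDomain D.A hz ψ)‖ ^ 2 +
        ‖(resolventToDomain D.A hz ψ : H)‖ ^ 2) := hC _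
    _ ≤ |C| * √(‖D.A (resolventToDomain D.A hz ψ)‖ ^ 2 +
        ‖(resolventToDomain D.A hz ψ : H)‖ ^ 2) := by
        gcongr
        exact le_abs_self C
    _ ≤ |C| * ((‖z‖ * (‖resolventOf D.A z‖ * ‖ψ‖) + ‖ψ‖) + ‖resolventOf D.A z‖ * ‖ψ‖) := by
        gcongr
        exact h3.trans (add_le_add h2 h4)
    _ = _ := by ring

open Classical in
/-- The bounded operator `τ R(z) : H → 𝔥`, for `z ∈ ρ(A)` (and `0` otherwise). -/
def traceResolvent (z : ℂ) : H →L[ℂ] 𝔥 :=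
  if hz : z ∈ resolventSetOf D.A then
    LinearMap.mkContinuousOfExistsBound (D.τ ∘ₗ resolventToDomain D.A hz)
      (D.exists_bound_trace_resolvent hz)
  else 0

/-- The bounded operator `G(z) = (τ R(z̄))* : 𝔥 → H`. -/
def G (z : ℂ) : 𝔥 →L[ℂ] H := (D.traceResolvent (conj z)).adjoint

/-- The families `Γ(z)`, `z ∈ ρ(A)`, of bounded operators in `𝔥` with
`Γ(z) - Γ(w) = (z - w) G(w̄)* G(z)` and `Γ(z)* = Γ(z̄)`. Values off `ρ(A)` play no role. -/
structure IsGammaFamily (Γ : ℂ → 𝔥 →L[ℂ] 𝔥) : Prop where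
  sub_eq : ∀ z ∈ resolventSetOf D.A, ∀ w ∈ resolventSetOf D.A,
    Γ z - Γ w = (z - w) • ((D.G (conj w)).adjoint ∘L D.G z)
  adjoint_eq : ∀ z ∈ resolventSetOf D.A, (Γ z).adjoint = Γ (conj z)

/-- `Γ` is the family `Γ̂(z) = τ ((G(i) + G(-i)) / 2 - G(z))`; in particular the vectors
to which `τ` is applied lie in `D(A)`. -/
def IsGammaHat (Γ : ℂ → 𝔥 →L[ℂ] 𝔥) : Prop :=
  ∀ z ∈ resolventSetOf D.A, ∀ ζ : 𝔥,
    ∃ h : (1 / 2 : ℂ) • (D.G I ζ + D.G (-I) ζ) - D.G z ζ ∈ D.A.domain, Γ z ζ = D.τ ⟨_, h⟩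

/-- The operator `Γ_{Π,Θ}(z) = Θ + Π Γ(z) Π`, with domain `D(Θ)`, in the range of `Π`. -/
def gammaPair (_D : TraceSetup H 𝔥) (Γ : ℂ → 𝔥 →L[ℂ] 𝔥) (x : PairBundle 𝔥) (z : ℂ) :
    x.1.space →ₗ.[ℂ] x.1.space :=
  (x.1.compress (Γ z) : x.1.space →ₗ[ℂ] x.1.space) +ᵥ x.2.1

/-- The set `Z_{Π,Θ} = {z ∈ ρ(A) : 0 ∈ ρ(Γ_{Π,Θ}(z))}`. -/
def Z (Γ : ℂ → 𝔥 →L[ℂ] 𝔥) (x : PairBundle 𝔥) : Set ℂ :=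
  {z | z ∈ resolventSetOf D.A ∧ (0 : ℂ) ∈ resolventSetOf (D.gammaPair Γ x z)}

/-- The bounded operator `G(z) Π Γ_{Π,Θ}(z)⁻¹ Π : 𝔥 → H`, for `z ∈ Z_{Π,Θ}`. -/
def correction (Γ : ℂ → 𝔥 →L[ℂ] 𝔥) (x : PairBundle 𝔥) (z : ℂ) : 𝔥 →L[ℂ] H :=
  D.G z ∘L x.1.space.subtypeL ∘L boundedInverse (D.gammaPair Γ x z) ∘L x.1.onto

/-- The graph of `A_{Π,Θ}`, written with the point `z ∈ Z_{Π,Θ}`: the pairs `(φ, ψ)` such that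
`φ = φ_z + G(z) Π Γ_{Π,Θ}(z)⁻¹ Π τ φ_z` and `-ψ + z φ = (-A + z) φ_z` for some `φ_z ∈ D(A)`. -/
def extensionGraph (Γ : ℂ → 𝔥 →L[ℂ] 𝔥) (x : PairBundle 𝔥) (z : ℂ) : Submodule ℂ (H × H) where
  carrier := {q | ∃ φz : D.A.domain,
    q.1 = (φz : H) + D.correction Γ x z (D.τ φz) ∧
    -q.2 + z • q.1 = -D.A φz + z • (φz : H)}
  zero_mem' := ⟨0, by simp, by simp⟩
  add_mem' := by
    rintro a b ⟨φ, h1, h2⟩ ⟨χ, h3, h4⟩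
    refine ⟨φ + χ, ?_, ?_⟩
    · simp only [Prod.fst_add, h1, h3, Submodule.coe_add, map_add]
      abel
    · have e : -(a + b).2 + z • (a + b).1 = (-a.2 + z • a.1) + (-b.2 + z • b.1) := by
        simp only [Prod.fst_add, Prod.snd_add, smul_add]
        abel
      rw [e, h2, h4, LinearPMap.map_add, Submodule.coe_add, smul_add]
      abel
  smul_mem' := by
    rintro c a ⟨φ, h1, h2⟩
    refine ⟨c • φ, ?_, ?_⟩
    · simp only [Prod.smul_fst, h1, Submodule.coe_smul, map_smul, smul_add]
    · have e : -(c • a).2 + z • (c • a).1 = c • (-a.2 + z • a.1) := by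
        simp only [Prod.smul_fst, Prod.smul_snd, smul_add, smul_neg, smul_comm z c]
      rw [e, h2, LinearPMap.map_smul, Submodule.coe_smul, smul_add, smul_neg, smul_comm z c]

/-- The operator `A_{Π,Θ}`, defined by means of the point `z = i` (which lies in every
`Z_{Π,Θ}`; the graph does not depend on the choice of the point). -/
def extension (Γ : ℂ → 𝔥 →L[ℂ] 𝔥) (x : PairBundle 𝔥) : H →ₗ.[ℂ] H :=
  (D.extensionGraph Γ x I).toLinearPMap

end TraceSetup

end

/-! The problem is transferred from `H` to `𝔥` through boundary values. For each `z ∈ ρ(A)`, every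
element of the graph of `S*` is uniquely `(φ + G(z)ξ, Aφ + z G(z)ξ)` with `φ ∈ D(A)` and `ξ ∈ 𝔥`
(`exists_defectPair_eq`, `defectPair_injective`): `G(z)` maps onto the defect space because `τR(z̄)`
is surjective, and its range meets `D(A)` only in `0` because `N` is dense. The vector `φ + G(z)ξ`
receives the boundary values `(ξ, τφ - Γ(z)ξ)`. These fill `𝔥 × 𝔥`, and the two identities for `Γ`
yield Green's identity (`green`) and independence of `z` (`boundaryRestriction_eq`).

Hence self-adjoint relations between `S` and `S*` correspond bijectively to self-adjoint relations
in `𝔥`. A relation in `H` obtained in this way is an operator, since its domain contains the dense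
`N`. In `𝔥` multivalued relations do occur, and each is uniquely `{(ξ, η) : ξ ∈ D(Θ), Θξ = Πη}` with
`ker Π` as multivalued part (`relation_injective`, `exists_relation_eq`). Solving this boundary
condition for `ξ` gives `ξ = Γ_{Π,Θ}(z)⁻¹Πτφ`, the stated formula (`extensionGraph_eq`).

A vector `φ ∈ D(A)` has boundary values `(0, τφ)`, so it lies in `D(A_{Π,Θ})` exactly when `Πτφ =
0`; as `τ` is onto, this means `τφ = 0` for all such `φ` exactly when `Π = 1`. -/

noncomputable section

/-! ### Self-adjoint linear relations -/

section Relations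

variable {E : Type*} [NormedAddCommGroup E] [InnerProductSpace ℂ E]

/-- A linear relation in a complex inner product space is self-adjoint if it equals its adjoint
relation. -/
def IsSelfAdjointRelation (L : Submodule ℂ (E × E)) : Prop :=
  ∀ q : E × E, q ∈ L ↔ ∀ r ∈ L, inner ℂ q.2 r.1 = inner ℂ q.1 r.2

namespace IsSelfAdjointRelation

variable {L : Submodule ℂ (E × E)}

theorem inner_eq (hL : IsSelfAdjointRelation L) {q r : E × E} (hq : q ∈ L) (hr : r ∈ L) :
    inner ℂ q.2 r.1 = inner ℂ q.1 r.2 :=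
  (hL q).1 hq r hr

theorem isClosed (hL : IsSelfAdjointRelation L) : IsClosed (L : Set (E × E)) := by
  have h : (L : Set (E × E)) =
      ⋂ r ∈ L, {q : E × E | inner ℂ q.2 r.1 = inner ℂ q.1 r.2} := by
    ext q
    simpa using hL q
  rw [h]
  refine isClosed_biInter fun r _ => isClosed_eq ?_ ?_ <;> fun_prop

theorem im_inner_eq_zero (hL : IsSelfAdjointRelation L) {q : E × E} (hq : q ∈ L) :
    (inner ℂ q.1 q.2).im = 0 := by
  rw [← Complex.conj_eq_iff_im, inner_conj_symm]
  exact hL.inner_eq hq hq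

theorem neg {T : E →ₗ.[ℂ] E} (hT : IsSelfAdjointRelation T.graph) :
    IsSelfAdjointRelation (-T).graph := by
  have h : ∀ q : E × E, q ∈ (-T).graph ↔ (q.1, -q.2) ∈ T.graph := by
    rintro ⟨a, b⟩
    simp only [LinearPMap.mem_graph_iff, LinearPMap.neg_apply]
    refine exists_congr fun y => and_congr_right fun _ => ?_
    exact neg_eq_iff_eq_neg
  intro q
  rw [h, hT]
  constructor
  · intro H r hr
    have := H _ ((h r).1 hr)
    simpa using this
  · intro H r hr
    have := H (r.1, -r.2) ((h _).2 (by simpa using hr))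
    simpa [neg_eq_iff_eq_neg] using this

/-- A self-adjoint relation with dense domain is the graph of an operator. -/
theorem snd_eq_zero_of_dense (hL : IsSelfAdjointRelation L) {s : Set E} (hs : Dense s)
    (hsL : ∀ x ∈ s, ∃ y, (x, y) ∈ L) {q : E × E} (hq : q ∈ L) (h0 : q.1 = 0) : q.2 = 0 := by
  refine hs.eq_zero_of_inner_left ℂ fun v hv => ?_
  obtain ⟨y, hy⟩ := hsL v hv
  simpa [h0] using hL.inner_eq hq hy

end IsSelfAdjointRelation

variable [CompleteSpace E]

/-- Density of the domain need not be assumed on the right: if `y` is orthogonal to the domain, then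
`(0, y)` lies in the adjoint relation, hence in the graph, so `y = 0`. -/
theorem isSelfAdjoint_iff_isSelfAdjointRelation {T : E →ₗ.[ℂ] E} :
    IsSelfAdjoint T ↔ IsSelfAdjointRelation T.graph := by
  have key : ∀ q : E × E, q ∈ T.graph.adjoint ↔
      ∀ r ∈ T.graph, inner ℂ q.2 r.1 = inner ℂ q.1 r.2 := by
    intro q
    rw [Submodule.mem_adjoint_iff]
    constructor
    · intro H r hr
      have := H r.1 r.2 hr
      rw [← inner_conj_symm, ← inner_conj_symm q.1, sub_eq_zero.1 this]
    · intro H a b hab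
      have := H _ hab
      rw [← inner_conj_symm, ← inner_conj_symm a, this, sub_self]
  constructor
  · intro hT q
    rw [← key, ← LinearPMap.adjoint_graph_eq_graph_adjoint hT.dense_domain,
      (LinearPMap.isSelfAdjoint_def).1 hT]
  · intro hT
    have hd : Dense (T.domain : Set E) := by
      rw [Submodule.dense_iff_topologicalClosure_eq_top,
        Submodule.topologicalClosure_eq_top_iff, Submodule.eq_bot_iff]
      intro y hy
      have : ((0 : E), y) ∈ T.graph := by
        rw [hT]
        intro r hr
        have := (Submodule.mem_orthogonal' _ _).1 hy r.1 (LinearPMap.mem_domain_of_mem_graph hr)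
        simpa using this
      exact T.graph_fst_eq_zero_snd this rfl
    rw [LinearPMap.isSelfAdjoint_def]
    apply LinearPMap.eq_of_eq_graph
    rw [LinearPMap.adjoint_graph_eq_graph_adjoint hd]
    ext q
    rw [key, ← hT q]

/-- A self-adjoint operator plus a bounded operator with definite imaginary part is boundedly
invertible. -/
theorem exists_isBoundedInverse_vadd {T : E →ₗ.[ℂ] E} (hT : IsSelfAdjointRelation T.graph)
    (C : E →L[ℂ] E) {c : ℝ} (hc : 0 < c)
    (hC : ∀ x, c * ‖x‖ ^ 2 ≤ |(inner ℂ x (C x)).im|) :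
    ∃ R, IsBoundedInverse ((C : E →ₗ[ℂ] E) +ᵥ T) R := by
  have : CompleteSpace T.graph := hT.isClosed.completeSpace_coe
  let f : T.graph →L[ℂ] E :=
    (ContinuousLinearMap.snd ℂ E E + C ∘L ContinuousLinearMap.fst ℂ E E) ∘L T.graph.subtypeL
  have hf : ∀ q : T.graph, f q = q.1.2 + C q.1.1 := fun q => rfl
  -- `⟨x, Tx⟩` is real, so only `C` contributes to the imaginary part of `⟨x, Tx + Cx⟩`.
  have hfst : ∀ q : T.graph, c * ‖q.1.1‖ ≤ ‖f q‖ := by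
    intro q
    have h1 : (inner ℂ q.1.1 (f q)).im = (inner ℂ q.1.1 (C q.1.1)).im := by
      rw [hf, inner_add_right, add_im, hT.im_inner_eq_zero q.2, zero_add]
    have h2 : c * ‖q.1.1‖ ^ 2 ≤ ‖q.1.1‖ * ‖f q‖ :=
      calc c * ‖q.1.1‖ ^ 2 ≤ |(inner ℂ q.1.1 (f q)).im| := h1 ▸ hC _
        _ ≤ ‖inner ℂ q.1.1 (f q)‖ := Complex.abs_im_le_norm _
        _ ≤ _ := norm_inner_le_norm _ _
    rcases eq_or_lt_of_le (norm_nonneg q.1.1) with h0 | h0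
    · rw [← h0]; simp
    · nlinarith
  -- The constant adds the bound `c⁻¹` for `x` to the bound `1 + ‖C‖ c⁻¹` for `Tx = f q - Cx`.
  have hK : (0 : ℝ) ≤ c⁻¹ + 1 + ‖C‖ * c⁻¹ := by positivity
  have hanti : AntilipschitzWith ⟨c⁻¹ + 1 + ‖C‖ * c⁻¹, hK⟩ f := by
    refine f.antilipschitz_of_bound fun q => ?_
    have h1 : ‖q.1.1‖ ≤ c⁻¹ * ‖f q‖ := by
      rw [inv_mul_eq_div, le_div_iff₀ hc, mul_comm]
      exact hfst q
    have h2 : ‖q.1.2‖ ≤ ‖f q‖ + ‖C‖ * (c⁻¹ * ‖f q‖) := by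
      have h3 : q.1.2 = f q - C q.1.1 := by rw [hf]; abel
      rw [h3]
      refine (norm_sub_le _ _).trans ?_
      gcongr
      exact (C.le_opNorm _).trans (by gcongr)
    change max ‖q.1.1‖ ‖q.1.2‖ ≤ (c⁻¹ + 1 + ‖C‖ * c⁻¹) * ‖f q‖
    have h4 : 0 ≤ c⁻¹ * ‖f q‖ := by positivity
    have h5 : 0 ≤ ‖C‖ * (c⁻¹ * ‖f q‖) := by positivity
    refine max_le ?_ ?_ <;> nlinarith [norm_nonneg (f q)]
  have hinj : Function.Injective f := hanti.injective
  have hclosed : IsClosed (f.range : Set E) := hanti.isClosed_range f.uniformContinuous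
  have hsurj : f.range = ⊤ := by
    have : CompleteSpace f.range := hclosed.completeSpace_coe
    rw [← Submodule.orthogonal_eq_bot_iff, Submodule.eq_bot_iff]
    intro y hy
    have hy' : ∀ q ∈ T.graph, inner ℂ y (q.2 + C q.1) = 0 := fun q hq =>
      (Submodule.mem_orthogonal' _ _).1 hy _ ⟨⟨q, hq⟩, rfl⟩
    -- A vector `y` orthogonal to the range satisfies `T*y = -C*y`. Since `T* = T`, the number `⟨y,
    -- C*y⟩` is real, which forces `y = 0`.
    have hmem : (y, -(C.adjoint y)) ∈ T.graph := by
      rw [hT]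
      intro q hq
      have := hy' q hq
      rw [inner_add_right] at this
      simp only [inner_neg_left, ContinuousLinearMap.adjoint_inner_left]
      exact neg_eq_of_add_eq_zero_left this
    have h1 := hT.im_inner_eq_zero hmem
    simp only [inner_neg_right, neg_im, ContinuousLinearMap.adjoint_inner_right, neg_eq_zero] at h1
    have h2 := hC y
    rw [← inner_conj_symm, conj_im, h1] at h2
    simp only [neg_zero, abs_zero] at h2
    have h3 : ‖y‖ ^ 2 ≤ 0 := by
      by_contra h
      push Not at h
      nlinarith
    exact norm_eq_zero.1 (pow_eq_zero_iff two_ne_zero |>.1 (le_antisymm h3 (sq_nonneg _)))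
  let e := ContinuousLinearEquiv.ofBijective f (LinearMap.ker_eq_bot.2 hinj) hsurj
  have he : ∀ q, e q = f q := fun q => rfl
  refine ⟨ContinuousLinearMap.fst ℂ E E ∘L T.graph.subtypeL ∘L (e.symm : E →L[ℂ] T.graph),
    fun x y => ?_⟩
  constructor
  · intro hx
    obtain ⟨q, rfl⟩ := e.surjective y
    obtain ⟨w, hw1, hw2⟩ := (LinearPMap.mem_graph_iff T).1 q.2
    have hxw : x = w := by
      rw [← hx, hw1]
      simp
    subst hxw
    refine ⟨w.2, ?_⟩
    rw [LinearPMap.vadd_apply, he, hf, ← hw2, add_comm, ← hw1]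
    rfl
  · rintro ⟨h, rfl⟩
    have h' : x ∈ T.domain := h
    have : ((C : E →ₗ[ℂ] E) +ᵥ T) ⟨x, h⟩ = e ⟨(x, T ⟨x, h'⟩), T.mem_graph ⟨x, h'⟩⟩ := by
      rw [he, hf, LinearPMap.vadd_apply, add_comm]
      rfl
    rw [this]
    simp

end Relations

/-! ### Resolvent sets of self-adjoint operators -/

section BoundedInverse

variable {E : Type*} [NormedAddCommGroup E] [InnerProductSpace ℂ E]

theorem isBoundedInverse_boundedInverse {T : E →ₗ.[ℂ] E} (h : ∃ R, IsBoundedInverse T R) :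
    IsBoundedInverse T (boundedInverse T) := by
  unfold boundedInverse
  rw [dif_pos h]
  exact h.choose_spec

theorem zero_mem_resolventSetOf_iff {T : E →ₗ.[ℂ] E} :
    (0 : ℂ) ∈ resolventSetOf T ↔ ∃ R, IsBoundedInverse T R := by
  have key : ∀ (x y : E), (∃ h : x ∈ (shifted T 0).domain, shifted T 0 ⟨x, h⟩ = y) ↔
      ∃ h : x ∈ T.domain, T ⟨x, h⟩ = -y := by
    intro x y
    refine exists_congr fun h => ?_
    have : shifted T 0 ⟨x, h⟩ = -T ⟨x, h⟩ := by
      change (0 : ℂ) • x + -T ⟨x, h⟩ = _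
      simp
    rw [this, neg_eq_iff_eq_neg]
  constructor
  · rintro ⟨R, hR⟩
    refine ⟨-R, fun x y => ?_⟩
    have := (hR x (-y)).trans (key x (-y))
    simpa using this
  · rintro ⟨R, hR⟩
    refine ⟨-R, fun x y => ?_⟩
    rw [key, ← hR]
    simp

theorem mem_resolventSetOf_of_im_ne_zero [CompleteSpace E] {T : E →ₗ.[ℂ] E}
    (hT : IsSelfAdjoint T) {z : ℂ} (hz : z.im ≠ 0) : z ∈ resolventSetOf T := by
  have hT' := (isSelfAdjoint_iff_isSelfAdjointRelation.1 hT).neg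
  refine exists_isBoundedInverse_vadd hT' (z • ContinuousLinearMap.id ℂ E)
    (abs_pos.2 hz) fun x => le_of_eq ?_
  have h : inner ℂ x x = ((‖x‖ ^ 2 : ℝ) : ℂ) := by
    rw [inner_self_eq_norm_sq_to_K]; norm_cast
  simp only [_root_.smul_apply, ContinuousLinearMap.id_apply, inner_smul_right, h,
    Complex.im_mul_ofReal, abs_mul]
  rw [abs_of_nonneg (sq_nonneg ‖x‖)]

theorem conj_mem_resolventSetOf [CompleteSpace E] {T : E →ₗ.[ℂ] E}
    (hT : IsSelfAdjoint T) {z : ℂ} (hz : z ∈ resolventSetOf T) :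
    conj z ∈ resolventSetOf T := by
  by_cases h : z.im = 0
  · rwa [Complex.conj_eq_iff_im.2 h]
  · exact mem_resolventSetOf_of_im_ne_zero hT (by simpa using h)

end BoundedInverse

/-! ### Adjoints of surjective bounded operators -/

section Adjoint

variable {E F : Type*} [NormedAddCommGroup E] [InnerProductSpace ℂ E] [CompleteSpace E]
  [NormedAddCommGroup F] [InnerProductSpace ℂ F] [CompleteSpace F]

/-- The adjoint of a surjective operator between Hilbert spaces is bounded below. -/
theorem exists_le_norm_adjoint_of_surjective {K : E →L[ℂ] F} (hK : Function.Surjective K) :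
    ∃ c : ℝ, 0 < c ∧ ∀ y, c * ‖y‖ ≤ ‖K.adjoint y‖ := by
  -- By the open mapping theorem `y = Kx` with `‖x‖ ≤ C‖y‖`; then `‖y‖² = ⟨x, K*y⟩` gives the bound.
  obtain ⟨C, hC, h⟩ := K.exists_preimage_norm_le hK
  refine ⟨C⁻¹, inv_pos.2 hC, fun y => ?_⟩
  rw [inv_mul_eq_div, div_le_iff₀ hC]
  obtain ⟨x, rfl, hx⟩ := h y
  rcases eq_or_lt_of_le (norm_nonneg (K x)) with h0 | h0
  · rw [← h0]; positivity
  · have h1 : ‖K x‖ ^ 2 ≤ ‖x‖ * ‖K.adjoint (K x)‖ := by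
      have h2 : inner ℂ x (K.adjoint (K x)) = ((‖K x‖ ^ 2 : ℝ) : ℂ) := by
        rw [ContinuousLinearMap.adjoint_inner_right, inner_self_eq_norm_sq_to_K]; norm_cast
      have h3 := norm_inner_le_norm (𝕜 := ℂ) x (K.adjoint (K x))
      rwa [h2, Complex.norm_real, Real.norm_of_nonneg (sq_nonneg _)] at h3
    have h4 : ‖x‖ * ‖K.adjoint (K x)‖ ≤ C * ‖K x‖ * ‖K.adjoint (K x)‖ := by gcongr
    nlinarith

/-- The range of the adjoint of a surjective operator is the orthogonal complement of the
kernel. -/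
theorem orthogonal_ker_of_surjective {K : E →L[ℂ] F} (hK : Function.Surjective K) :
    K.kerᗮ = K.adjoint.range := by
  obtain ⟨c, hc, h⟩ := exists_le_norm_adjoint_of_surjective hK
  have hanti : AntilipschitzWith ⟨c⁻¹, (inv_pos.2 hc).le⟩ K.adjoint := by
    refine K.adjoint.antilipschitz_of_bound fun y => ?_
    change ‖y‖ ≤ c⁻¹ * _
    rw [inv_mul_eq_div, le_div_iff₀ hc, mul_comm]
    exact h y
  rw [K.orthogonal_ker]
  exact IsClosed.submodule_topologicalClosure_eq
    (hanti.isClosed_range K.adjoint.uniformContinuous)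

end Adjoint

/-! ### The operators `G(z)` and the defect spaces of `S` -/

namespace TraceSetup

variable {H 𝔥 : Type*}
  [NormedAddCommGroup H] [InnerProductSpace ℂ H] [CompleteSpace H]
  [NormedAddCommGroup 𝔥] [InnerProductSpace ℂ 𝔥] [CompleteSpace 𝔥]
  (D : TraceSetup H 𝔥)

theorem isSelfAdjointRelation_graph : IsSelfAdjointRelation D.A.graph :=
  isSelfAdjoint_iff_isSelfAdjointRelation.1 D.selfAdjoint

theorem inner_A_left (φ χ : D.A.domain) :
    inner ℂ (D.A φ) (χ : H) = inner ℂ (φ : H) (D.A χ) :=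
  D.isSelfAdjointRelation_graph.inner_eq (D.A.mem_graph φ) (D.A.mem_graph χ)

theorem dense_N : Dense (D.N : Set H) := D.dense_ker

theorem mem_N {φ : H} : φ ∈ D.N ↔ ∃ χ : D.A.domain, D.τ χ = 0 ∧ (χ : H) = φ := by
  simp [N]

variable {D} {z w : ℂ}

theorem exists_shift_eq (hz : z ∈ resolventSetOf D.A) (ψ : H) :
    ∃ φ : D.A.domain, z • (φ : H) - D.A φ = ψ := by
  refine ⟨resolventToDomain D.A hz ψ, ?_⟩
  have : D.A (resolventToDomain D.A hz ψ) = z • resolventOf D.A z ψ - ψ := apply_resolventOf hz ψ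
  rw [this]
  exact sub_sub_cancel _ _

theorem resolventToDomain_shift (hz : z ∈ resolventSetOf D.A) (φ : D.A.domain) :
    resolventToDomain D.A hz (z • (φ : H) - D.A φ) = φ := by
  apply Subtype.ext
  refine (isBoundedInverse_resolventOf hz _ _).2 ⟨φ.2, ?_⟩
  rw [sub_eq_add_neg]
  rfl

theorem traceResolvent_apply (hz : z ∈ resolventSetOf D.A) (ψ : H) :
    D.traceResolvent z ψ = D.τ (resolventToDomain D.A hz ψ) := by
  rw [traceResolvent, dif_pos hz]
  rfl

theorem traceResolvent_shift (hz : z ∈ resolventSetOf D.A) (φ : D.A.domain) :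
    D.traceResolvent z (z • (φ : H) - D.A φ) = D.τ φ := by
  rw [traceResolvent_apply hz, resolventToDomain_shift]

theorem traceResolvent_surjective (hz : z ∈ resolventSetOf D.A) :
    Function.Surjective (D.traceResolvent z) := fun ξ => by
  obtain ⟨φ, rfl⟩ := D.surjective ξ
  exact ⟨_, traceResolvent_shift hz φ⟩

theorem conj_mem (hz : z ∈ resolventSetOf D.A) : conj z ∈ resolventSetOf D.A :=
  conj_mem_resolventSetOf D.selfAdjoint hz

theorem I_mem : I ∈ resolventSetOf D.A :=
  mem_resolventSetOf_of_im_ne_zero D.selfAdjoint (by simp)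

theorem neg_I_mem : -I ∈ resolventSetOf D.A :=
  mem_resolventSetOf_of_im_ne_zero D.selfAdjoint (by simp)

theorem G_adjoint (z : ℂ) : (D.G z).adjoint = D.traceResolvent (conj z) := by
  rw [G, ContinuousLinearMap.adjoint_adjoint]

theorem inner_G_shift (hz : z ∈ resolventSetOf D.A) (ξ : 𝔥) (φ : D.A.domain) :
    inner ℂ (D.G z ξ) (conj z • (φ : H) - D.A φ) = inner ℂ ξ (D.τ φ) := by
  rw [G, ContinuousLinearMap.adjoint_inner_left, traceResolvent_shift (conj_mem hz)]

theorem inner_G_A (hz : z ∈ resolventSetOf D.A) (ξ : 𝔥) (φ : D.A.domain) :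
    inner ℂ (D.G z ξ) (D.A φ) = conj z * inner ℂ (D.G z ξ) (φ : H) - inner ℂ ξ (D.τ φ) := by
  rw [← inner_G_shift hz, inner_sub_right, inner_smul_right]
  ring

theorem exists_le_norm_G (hz : z ∈ resolventSetOf D.A) :
    ∃ c : ℝ, 0 < c ∧ ∀ ξ, c * ‖ξ‖ ≤ ‖D.G z ξ‖ :=
  exists_le_norm_adjoint_of_surjective (traceResolvent_surjective (conj_mem hz))

/-- The difference `G(z) - G(w)` takes values in the domain of `A`. -/
theorem exists_G_sub (hz : z ∈ resolventSetOf D.A) (hw : w ∈ resolventSetOf D.A) (ξ : 𝔥) :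
    ∃ φ : D.A.domain, (φ : H) = D.G z ξ - D.G w ξ ∧
      D.A φ = z • D.G z ξ - w • D.G w ξ ∧
      D.τ φ = (w - z) • (D.G (conj w)).adjoint (D.G z ξ) := by
  -- The witness comes from the resolvent identity `G(z) - G(w) = (w - z) R(w) G(z)`, checked below
  -- against the vectors `(w̄ - A)φ`, which fill `H`.
  set ρ := resolventToDomain D.A hw (D.G z ξ) with hρ
  have hAρ : D.A ρ = w • (ρ : H) - D.G z ξ := apply_resolventOf hw _
  have h1 : (w - z) • (ρ : H) = D.G z ξ - D.G w ξ := by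
    rw [← sub_eq_zero]
    refine ext_inner_right ℂ fun ψ => ?_
    obtain ⟨φ, rfl⟩ := exists_shift_eq (conj_mem hw) ψ
    have h2 : inner ℂ (ρ : H) (D.A φ) =
        conj w * inner ℂ (ρ : H) (φ : H) - inner ℂ (D.G z ξ) (φ : H) := by
      rw [← inner_A_left, hAρ, inner_sub_left, inner_smul_left]
    simp only [inner_sub_left, inner_sub_right, inner_smul_left, inner_smul_right, h2,
      inner_G_A hz, inner_G_A hw, map_sub, inner_zero_left]
    ring
  refine ⟨(w - z) • ρ, h1, ?_, ?_⟩
  · have h3 : D.G w ξ = D.G z ξ - (w - z) • (ρ : H) := by rw [h1]; abel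
    rw [LinearPMap.map_smul, hAρ, h3]
    module
  · rw [map_smul, G_adjoint, Complex.conj_conj, traceResolvent_apply hw]

/-- Here the density of `N` enters: `(z - A)G(z)ξ` is orthogonal to `N`, hence zero, so `G(z)ξ = 0`,
and `G(z)` is bounded below. -/
theorem eq_zero_of_G_mem (hz : z ∈ resolventSetOf D.A) {ξ : 𝔥} (h : D.G z ξ ∈ D.A.domain) :
    ξ = 0 := by
  have h1 : z • D.G z ξ - D.A ⟨_, h⟩ = 0 := by
    refine D.dense_N.eq_zero_of_inner_left ℂ fun v hv => ?_
    obtain ⟨φ, hφ, rfl⟩ := D.mem_N.1 hv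
    rw [inner_sub_left, inner_smul_left, inner_A_left, inner_G_A hz, hφ]
    simp
  have h2 : (⟨D.G z ξ, h⟩ : D.A.domain) = 0 := by
    rw [← resolventToDomain_shift hz ⟨D.G z ξ, h⟩, h1, map_zero]
  have h3 : D.G z ξ = 0 := congrArg Subtype.val h2
  obtain ⟨c, hc, hG⟩ := exists_le_norm_G hz
  have h4 := hG ξ
  rw [h3, norm_zero] at h4
  have h5 : ‖ξ‖ ≤ 0 := by
    by_contra h
    push Not at h
    nlinarith
  exact norm_le_zero_iff.1 h5

/-- The hypothesis says `χ ⊥ ker τR(z̄)`; as `τR(z̄)` is onto, this complement is the range of its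
adjoint `G(z)`. -/
theorem exists_eq_G_of_inner_eq_zero (hz : z ∈ resolventSetOf D.A) {χ : H}
    (h : ∀ φ : D.A.domain, D.τ φ = 0 → inner ℂ χ (conj z • (φ : H) - D.A φ) = 0) :
    ∃ ξ, D.G z ξ = χ := by
  have h1 : χ ∈ (D.traceResolvent (conj z)).kerᗮ := by
    rw [Submodule.mem_orthogonal']
    intro u hu
    obtain ⟨φ, rfl⟩ := exists_shift_eq (conj_mem hz) u
    refine h φ ?_
    rw [← traceResolvent_shift (conj_mem hz)]
    exact hu
  rw [orthogonal_ker_of_surjective (traceResolvent_surjective (conj_mem hz))] at h1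
  exact h1

/-! ### Boundary values -/

variable (D) in
/-- Elements of the graph of `S*`, written as `(φ + G(z) ξ, A φ + z G(z) ξ)`. -/
def defectPair (z : ℂ) : D.A.domain × 𝔥 →ₗ[ℂ] H × H :=
  LinearMap.coprod (LinearMap.prod D.A.domain.subtype D.A.toFun)
    (LinearMap.prod (D.G z : 𝔥 →ₗ[ℂ] H) (z • (D.G z : 𝔥 →ₗ[ℂ] H)))

variable (D) in
/-- The boundary values `(ξ, τ φ - Γ(z) ξ)` of the vector `φ + G(z) ξ`. -/
def boundaryValue (Γ : ℂ → 𝔥 →L[ℂ] 𝔥) (z : ℂ) : D.A.domain × 𝔥 →ₗ[ℂ] 𝔥 × 𝔥 :=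
  LinearMap.prod (LinearMap.snd ℂ _ _)
    (D.τ ∘ₗ LinearMap.fst ℂ _ _ - (Γ z : 𝔥 →ₗ[ℂ] 𝔥) ∘ₗ LinearMap.snd ℂ _ _)

variable (D) in
/-- The restriction of `S*` given by the boundary condition `θ`, as a relation. -/
def boundaryRestriction (Γ : ℂ → 𝔥 →L[ℂ] 𝔥) (z : ℂ) (θ : Submodule ℂ (𝔥 × 𝔥)) :
    Submodule ℂ (H × H) :=
  (θ.comap (D.boundaryValue Γ z)).map (D.defectPair z)

variable {Γ : ℂ → 𝔥 →L[ℂ] 𝔥} {θ : Submodule ℂ (𝔥 × 𝔥)}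

theorem defectPair_apply (z : ℂ) (p : D.A.domain × 𝔥) :
    D.defectPair z p = ((p.1 : H) + D.G z p.2, D.A p.1 + z • D.G z p.2) := rfl

theorem boundaryValue_apply (z : ℂ) (p : D.A.domain × 𝔥) :
    D.boundaryValue Γ z p = (p.2, D.τ p.1 - Γ z p.2) := rfl

theorem mem_boundaryRestriction {q : H × H} :
    q ∈ D.boundaryRestriction Γ z θ ↔
      ∃ p, D.boundaryValue Γ z p ∈ θ ∧ D.defectPair z p = q := by
  simp only [boundaryRestriction, Submodule.mem_map, Submodule.mem_comap]

theorem defectPair_injective (hz : z ∈ resolventSetOf D.A) :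
    Function.Injective (D.defectPair z) := by
  rw [← LinearMap.ker_eq_bot, Submodule.eq_bot_iff]
  rintro ⟨φ, ξ⟩ h
  have h1 : (φ : H) + D.G z ξ = 0 := congrArg Prod.fst (LinearMap.mem_ker.1 h)
  have h2 : ξ = 0 := by
    refine eq_zero_of_G_mem hz ?_
    rw [← neg_eq_of_add_eq_zero_right h1]
    exact neg_mem φ.2
  subst h2
  rw [map_zero, add_zero] at h1
  exact Prod.ext (Subtype.ext h1) rfl

theorem boundaryValue_surjective (Γ : ℂ → 𝔥 →L[ℂ] 𝔥) (z : ℂ) :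
    Function.Surjective (D.boundaryValue Γ z) := by
  rintro ⟨ξ, η⟩
  obtain ⟨φ, hφ⟩ := D.surjective (η + Γ z ξ)
  exact ⟨(φ, ξ), by rw [boundaryValue_apply]; simp [hφ]⟩

/-- Both identities for `Γ` are used at `w = z̄`, giving `Γ(z) - Γ(z)* = (z - z̄) G(z)*G(z)`. -/
theorem inner_gamma_sub (hΓ : D.IsGammaFamily Γ) (hz : z ∈ resolventSetOf D.A) (ξ η : 𝔥) :
    inner ℂ (Γ z ξ) η - inner ℂ ξ (Γ z η) =
      (conj z - z) * inner ℂ (D.G z ξ) (D.G z η) := by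
  have h3 := hΓ.sub_eq z hz (conj z) (conj_mem hz)
  rw [← ContinuousLinearMap.adjoint_inner_right, hΓ.adjoint_eq z hz, ← inner_sub_right,
    ← sub_apply, ← neg_sub, h3]
  simp only [Complex.conj_conj, neg_apply, _root_.smul_apply,
    ContinuousLinearMap.comp_apply, inner_neg_right, inner_smul_right,
    ContinuousLinearMap.adjoint_inner_right]
  ring

/-- Green's identity. -/
theorem green (hΓ : D.IsGammaFamily Γ) (hz : z ∈ resolventSetOf D.A) (p r : D.A.domain × 𝔥) :
    inner ℂ (D.defectPair z p).2 (D.defectPair z r).1 -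
        inner ℂ (D.defectPair z p).1 (D.defectPair z r).2 =
      inner ℂ (D.boundaryValue Γ z p).1 (D.boundaryValue Γ z r).2 -
        inner ℂ (D.boundaryValue Γ z p).2 (D.boundaryValue Γ z r).1 := by
  obtain ⟨φ, ξ⟩ := p
  obtain ⟨χ, η⟩ := r
  have h1 := inner_gamma_sub hΓ hz ξ η
  have h4 : inner ℂ (D.A φ) (D.G z η) =
      z * inner ℂ (φ : H) (D.G z η) - inner ℂ (D.τ φ) η := by
    have := congrArg conj (inner_G_A hz η φ)
    simpa only [map_sub, map_mul, inner_conj_symm, Complex.conj_conj] using this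
  simp only [defectPair_apply, boundaryValue_apply, inner_add_left, inner_add_right,
    inner_sub_left, inner_sub_right, inner_smul_left, inner_smul_right, inner_A_left,
    inner_G_A hz, h4]
  linear_combination -h1

theorem isSelfAdjointRelation_of_boundaryRestriction (hΓ : D.IsGammaFamily Γ)
    (hz : z ∈ resolventSetOf D.A)
    (h : IsSelfAdjointRelation (D.boundaryRestriction Γ z θ)) : IsSelfAdjointRelation θ := by
  have key : ∀ p, D.defectPair z p ∈ D.boundaryRestriction Γ z θ ↔
      D.boundaryValue Γ z p ∈ θ := by
    intro p
    rw [mem_boundaryRestriction]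
    exact ⟨fun ⟨r, hr, e⟩ => defectPair_injective hz e ▸ hr, fun hp => ⟨p, hp, rfl⟩⟩
  intro q
  obtain ⟨p, rfl⟩ := boundaryValue_surjective (D := D) Γ z q
  rw [← key, h]
  constructor
  · intro H r hr
    obtain ⟨s, rfl⟩ := boundaryValue_surjective (D := D) Γ z r
    have := green hΓ hz p s
    rw [H (D.defectPair z s) ((key s).2 hr), sub_self] at this
    exact (sub_eq_zero.1 this.symm).symm
  · intro H r hr
    obtain ⟨s, hs, rfl⟩ := mem_boundaryRestriction.1 hr
    have := green hΓ hz p s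
    rw [H (D.boundaryValue Γ z s) hs, sub_self] at this
    exact sub_eq_zero.1 this

theorem mk_mem_boundaryRestriction (θ : Submodule ℂ (𝔥 × 𝔥)) {φ : D.A.domain}
    (hφ : D.τ φ = 0) : ((φ : H), D.A φ) ∈ D.boundaryRestriction Γ z θ := by
  refine mem_boundaryRestriction.2 ⟨(φ, 0), ?_, ?_⟩
  · rw [boundaryValue_apply, hφ, map_zero, sub_zero]
    exact zero_mem θ
  · simp [defectPair_apply]

/-- The adjoint of `S` consists of the pairs `(φ + G(z) ξ, A φ + z G(z) ξ)`. -/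
theorem exists_defectPair_eq (hz : z ∈ resolventSetOf D.A) {q : H × H}
    (h : ∀ φ : D.A.domain, D.τ φ = 0 → inner ℂ q.2 (φ : H) = inner ℂ q.1 (D.A φ)) :
    ∃ p, D.defectPair z p = q := by
  -- The `D(A)` component must satisfy `(z - A)χ = z q₁ - q₂`; the remainder `q₁ - χ` then lies in
  -- the defect space.
  obtain ⟨χ, hχ⟩ := exists_shift_eq hz (z • q.1 - q.2)
  have hA : D.A χ = z • (χ : H) - (z • q.1 - q.2) := by rw [← hχ]; abel
  obtain ⟨ξ, hξ⟩ := exists_eq_G_of_inner_eq_zero (χ := q.1 - χ) hz fun φ hφ => by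
    have h1 : inner ℂ (χ : H) (D.A φ) = conj z * inner ℂ (χ : H) (φ : H) -
        (conj z * inner ℂ q.1 (φ : H) - inner ℂ q.2 (φ : H)) := by
      rw [← inner_A_left, hA]
      simp only [inner_sub_left, inner_smul_left]
    simp only [inner_sub_left, inner_sub_right, inner_smul_right, h1, h φ hφ]
    ring
  refine ⟨(χ, ξ), ?_⟩
  rw [defectPair_apply]
  simp only [hξ, hA]
  refine Prod.ext ?_ ?_
  · simp
  · simp only [smul_sub]; abel

theorem isSelfAdjointRelation_boundaryRestriction (hΓ : D.IsGammaFamily Γ)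
    (hz : z ∈ resolventSetOf D.A) (h : IsSelfAdjointRelation θ) :
    IsSelfAdjointRelation (D.boundaryRestriction Γ z θ) := by
  intro q
  constructor
  · intro hq r hr
    obtain ⟨p, hp, rfl⟩ := mem_boundaryRestriction.1 hq
    obtain ⟨s, hs, rfl⟩ := mem_boundaryRestriction.1 hr
    rw [← sub_eq_zero, green hΓ hz, h.inner_eq hp hs, sub_self]
  · intro H
    -- The restriction contains the graph of `S`, so anything in its adjoint lies in the graph of
    -- `S*` and has boundary values.
    obtain ⟨p, rfl⟩ := exists_defectPair_eq hz fun φ hφ =>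
      H _ (mk_mem_boundaryRestriction (Γ := Γ) θ hφ)
    refine mem_boundaryRestriction.2 ⟨p, (h _).2 fun r hr => ?_, rfl⟩
    obtain ⟨s, rfl⟩ := boundaryValue_surjective (D := D) Γ z r
    have := green hΓ hz p s
    rw [H (D.defectPair z s) (mem_boundaryRestriction.2 ⟨s, hr, rfl⟩), sub_self] at this
    exact (sub_eq_zero.1 this.symm).symm

/-- Passing from `z` to `w` moves `χ = (G(z) - G(w))ξ` into the `D(A)` component. The boundary
values do not change, because `τχ = Γ(w)ξ - Γ(z)ξ`. -/
theorem boundaryRestriction_le (hΓ : D.IsGammaFamily Γ) (hz : z ∈ resolventSetOf D.A)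
    (hw : w ∈ resolventSetOf D.A) :
    D.boundaryRestriction Γ z θ ≤ D.boundaryRestriction Γ w θ := by
  intro q hq
  obtain ⟨⟨φ, ξ⟩, hp, rfl⟩ := mem_boundaryRestriction.1 hq
  obtain ⟨χ, h1, h2, h3⟩ := exists_G_sub hz hw ξ
  have h5 : Γ w ξ = Γ z ξ + D.τ χ := by
    have := congrArg (fun T : 𝔥 →L[ℂ] 𝔥 => T ξ) (hΓ.sub_eq z hz w hw)
    simp only [sub_apply, _root_.smul_apply, ContinuousLinearMap.comp_apply] at this
    rw [h3, ← neg_sub z w, neg_smul, ← this]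
    abel
  refine mem_boundaryRestriction.2 ⟨(φ + χ, ξ), ?_, ?_⟩
  · rw [boundaryValue_apply] at hp ⊢
    have : D.τ (φ + χ) - Γ w ξ = D.τ φ - Γ z ξ := by rw [h5, map_add]; abel
    simpa only [this] using hp
  · rw [defectPair_apply, defectPair_apply]
    refine Prod.ext ?_ ?_
    · simp only [Submodule.coe_add, h1]; abel
    · simp only [LinearPMap.map_add, h2]; abel

theorem boundaryRestriction_eq (hΓ : D.IsGammaFamily Γ) (hz : z ∈ resolventSetOf D.A)
    (hw : w ∈ resolventSetOf D.A) :
    D.boundaryRestriction Γ z θ = D.boundaryRestriction Γ w θ :=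
  le_antisymm (boundaryRestriction_le hΓ hz hw) (boundaryRestriction_le hΓ hw hz)

theorem boundaryRestriction_injective (hz : z ∈ resolventSetOf D.A) :
    Function.Injective (D.boundaryRestriction Γ z) :=
  (Submodule.map_injective_of_injective (defectPair_injective hz)).comp
    (Submodule.comap_injective_of_surjective (boundaryValue_surjective Γ z))

/-- Every relation between `S` and `S*` is given by a boundary condition. -/
theorem exists_boundaryRestriction_eq (Γ : ℂ → 𝔥 →L[ℂ] 𝔥) (hz : z ∈ resolventSetOf D.A)
    {L : Submodule ℂ (H × H)} (hL : IsSelfAdjointRelation L)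
    (hS : ∀ φ : D.A.domain, D.τ φ = 0 → ((φ : H), D.A φ) ∈ L) :
    ∃ θ, D.boundaryRestriction Γ z θ = L := by
  refine ⟨(L.comap (D.defectPair z)).map (D.boundaryValue Γ z), ?_⟩
  -- Vanishing boundary values mean membership in the graph of `S`, so taking the image and then the
  -- preimage under the boundary map adds nothing to `L`.
  have hle : LinearMap.ker (D.boundaryValue Γ z) ≤ L.comap (D.defectPair z) := by
    rintro ⟨φ, ξ⟩ h
    have h1 := LinearMap.mem_ker.1 h
    rw [boundaryValue_apply, Prod.mk_eq_zero] at h1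
    obtain ⟨rfl : ξ = 0, h2⟩ := h1
    have h3 : D.τ φ = 0 := by simpa using h2
    simpa [defectPair_apply] using hS φ h3
  rw [boundaryRestriction, Submodule.comap_map_eq, sup_eq_left.2 hle, Submodule.map_comap_eq,
    inf_eq_right]
  intro q hq
  exact exists_defectPair_eq hz fun φ hφ => hL.inner_eq hq (hS φ hφ)

end TraceSetup

/-! ### Pairs `(Π, Θ)` and self-adjoint relations in `𝔥` -/

section Bundle

variable {𝔥 : Type*} [NormedAddCommGroup 𝔥] [InnerProductSpace ℂ 𝔥] [CompleteSpace 𝔥]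

namespace OrthProj

variable (P : OrthProj 𝔥)

theorem coe_onto (η : 𝔥) : (P.onto η : 𝔥) = P.1 η := rfl

theorem apply_coe (a : P.space) : P.1 (a : 𝔥) = a := by
  obtain ⟨_, y, rfl⟩ := a
  exact congrArg (fun T : 𝔥 →L[ℂ] 𝔥 => T y) P.2.isIdempotentElem

theorem onto_coe (a : P.space) : P.onto (a : 𝔥) = a := Subtype.ext (P.apply_coe a)

theorem inner_apply_left (ξ η : 𝔥) : inner ℂ (P.1 ξ) η = inner ℂ ξ (P.1 η) :=
  P.2.isSelfAdjoint.isSymmetric ξ η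

theorem inner_onto_left (η : 𝔥) (a : P.space) : inner ℂ (P.onto η) a = inner ℂ η (a : 𝔥) := by
  rw [Submodule.coe_inner, coe_onto, inner_apply_left, apply_coe]

theorem inner_onto_right (a : P.space) (η : 𝔥) : inner ℂ a (P.onto η) = inner ℂ (a : 𝔥) η := by
  rw [Submodule.coe_inner, coe_onto, ← inner_apply_left, apply_coe]

theorem eq_of_apply_eq_zero_iff {P Q : OrthProj 𝔥} (h : ∀ η, P.1 η = 0 ↔ Q.1 η = 0) : P = Q := by
  -- From `ker Q ⊆ ker P` follows `PQ = P`; the reverse inclusion gives `QP = Q`, and symmetry of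
  -- both projections yields `P = Q`.
  have key : ∀ {P Q : OrthProj 𝔥}, (∀ η, Q.1 η = 0 → P.1 η = 0) → ∀ η, P.1 (Q.1 η) = P.1 η := by
    intro P Q h η
    have := h (η - Q.1 η) (by rw [map_sub, sub_eq_zero]; exact (Q.apply_coe (Q.onto η)).symm)
    rw [map_sub, sub_eq_zero] at this
    exact this.symm
  apply Subtype.ext
  ext η
  refine ext_inner_right ℂ fun ξ => ?_
  rw [← key (fun η => (h η).1) η, Q.inner_apply_left, P.inner_apply_left,
    ← key (fun η => (h η).2) ξ, ← P.inner_apply_left]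

theorem eq_id_iff {P : OrthProj 𝔥} : P = OrthProj.id ↔ ∀ η, P.1 η = 0 → η = 0 := by
  constructor
  · rintro rfl η h
    exact h
  · intro h
    exact eq_of_apply_eq_zero_iff fun η => ⟨h η, fun h' => by
      have : η = 0 := h'
      rw [this, map_zero]⟩

end OrthProj

namespace PairBundle

/-- The self-adjoint relation `{(ξ, η) : ξ ∈ D(Θ), Θ ξ = Π η}` of the pair `(Π, Θ)`. -/
def relation (x : PairBundle 𝔥) : Submodule ℂ (𝔥 × 𝔥) :=
  (x.2.1.graph.comap
    (LinearMap.prodMap (LinearMap.id : x.1.space →ₗ[ℂ] x.1.space)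
      (x.1.onto : 𝔥 →ₗ[ℂ] x.1.space))).map
    (LinearMap.prodMap x.1.space.subtype (LinearMap.id : 𝔥 →ₗ[ℂ] 𝔥))

theorem mem_relation {x : PairBundle 𝔥} {q : 𝔥 × 𝔥} :
    q ∈ x.relation ↔ ∃ a : x.1.space, (a, x.1.onto q.2) ∈ x.2.1.graph ∧ (a : 𝔥) = q.1 := by
  rw [relation, Submodule.mem_map]
  constructor
  · rintro ⟨⟨a, η⟩, h, rfl⟩
    exact ⟨a, h, rfl⟩
  · rintro ⟨a, h, h'⟩
    exact ⟨(a, q.2), h, Prod.ext h' rfl⟩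

theorem mk_coe_mem_relation {x : PairBundle 𝔥} {a : x.1.space} {η : 𝔥} :
    ((a : 𝔥), η) ∈ x.relation ↔ (a, x.1.onto η) ∈ x.2.1.graph := by
  rw [mem_relation]
  exact ⟨fun ⟨b, h, e⟩ => Subtype.ext e ▸ h, fun h => ⟨a, h, rfl⟩⟩

theorem mk_zero_mem_relation {x : PairBundle 𝔥} {η : 𝔥} :
    ((0 : 𝔥), η) ∈ x.relation ↔ x.1.1 η = 0 := by
  have := mk_coe_mem_relation (x := x) (a := 0) (η := η)
  rw [Submodule.coe_zero] at this
  rw [this, ← x.1.coe_onto, Submodule.coe_eq_zero]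
  refine ⟨fun h => x.2.1.graph_fst_eq_zero_snd h rfl, fun h => ?_⟩
  rw [h]
  exact zero_mem _

theorem isSelfAdjointRelation_relation (x : PairBundle 𝔥) :
    IsSelfAdjointRelation x.relation := by
  have hΘ := isSelfAdjoint_iff_isSelfAdjointRelation.1 x.2.2
  intro q
  constructor
  · intro hq r hr
    obtain ⟨a, ha, ha'⟩ := mem_relation.1 hq
    obtain ⟨b, hb, hb'⟩ := mem_relation.1 hr
    have := hΘ.inner_eq ha hb
    rwa [x.1.inner_onto_left, x.1.inner_onto_right, ha', hb'] at this
  · intro h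
    obtain ⟨ξ, η⟩ := q
    have h1 : x.1.1 ξ = ξ := by
      refine ext_inner_right ℂ fun ζ => ?_
      -- Testing against the multivalued part `ker Π` forces `ξ` into the range of `Π`.
      have h2 := h (0, ζ - x.1.1 ζ) (mk_zero_mem_relation.2 (by
        rw [map_sub, sub_eq_zero]; exact (x.1.apply_coe (x.1.onto ζ)).symm))
      simp only [inner_zero_right, inner_sub_right] at h2
      rw [x.1.inner_apply_left]
      exact (sub_eq_zero.1 h2.symm).symm
    have h3 : ((x.1.onto ξ : x.1.space) : 𝔥) = ξ := h1
    rw [← h3, mk_coe_mem_relation, hΘ]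
    rintro ⟨a, b⟩ hr
    have h4 := h (a, b) (mk_coe_mem_relation.2 (by rwa [x.1.onto_coe]))
    simp only [x.1.inner_onto_left]
    exact h4

/-- The multivalued part determines `ker Π`, hence `Π`; the pairs with both entries in the range of
`Π` then give the graph of `Θ`. -/
theorem relation_injective : Function.Injective (relation (𝔥 := 𝔥)) := by
  intro x y h
  have hP : x.1 = y.1 := OrthProj.eq_of_apply_eq_zero_iff fun η => by
    rw [← mk_zero_mem_relation, ← mk_zero_mem_relation, h]
  obtain ⟨P, Θ, hΘ⟩ := x
  obtain ⟨Q, Ξ, hΞ⟩ := y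
  obtain rfl : P = Q := hP
  have : Θ = Ξ := by
    apply LinearPMap.eq_of_eq_graph
    ext ⟨a, b⟩
    have h1 := mk_coe_mem_relation (x := ⟨P, Θ, hΘ⟩) (a := a) (η := b)
    have h2 := mk_coe_mem_relation (x := ⟨P, Ξ, hΞ⟩) (a := a) (η := b)
    rw [P.onto_coe] at h1 h2
    exact h1.symm.trans ((SetLike.ext_iff.1 h _).trans h2)
  subst this
  rfl

/-- Every self-adjoint relation is an orthogonal sum of an operator and a multivalued part. -/
theorem exists_relation_eq {θ : Submodule ℂ (𝔥 × 𝔥)} (hθ : IsSelfAdjointRelation θ) :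
    ∃ x : PairBundle 𝔥, x.relation = θ := by
  -- `M` is the multivalued part of `θ`. `Π` projects onto `Mᗮ`, which contains the domain of `θ`,
  -- and `Θ` has as graph the part of `θ` in `Mᗮ × Mᗮ`.
  let M : Submodule ℂ 𝔥 := θ.comap (LinearMap.inr ℂ 𝔥 𝔥)
  have hM : ∀ η, η ∈ M ↔ ((0 : 𝔥), η) ∈ θ := fun η => Iff.rfl
  have hMc : IsClosed (M : Set 𝔥) :=
    hθ.isClosed.preimage (continuous_const.prodMk continuous_id)
  have : CompleteSpace M := hMc.completeSpace_coe
  obtain ⟨P, hPM⟩ : ∃ P : OrthProj 𝔥, P.1 = Mᗮ.starProjection :=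
    ⟨⟨_, isStarProjection_starProjection⟩, rfl⟩
  have hP : P.space = Mᗮ := by
    rw [OrthProj.space, hPM]
    exact Submodule.range_starProjection Mᗮ
  have hfst : ∀ q ∈ θ, q.1 ∈ P.space := by
    intro q hq
    rw [hP, Submodule.mem_orthogonal]
    intro η hη
    have := hθ.inner_eq ((hM η).1 hη) hq
    simpa using this
  have hsub : ∀ η, ((0 : 𝔥), η - P.1 η) ∈ θ := by
    intro η
    rw [← hM, hPM]
    have := Mᗮ.sub_starProjection_mem_orthogonal η
    rwa [Submodule.orthogonal_orthogonal] at this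
  have hproj : ∀ ξ η, (ξ, P.1 η) ∈ θ ↔ (ξ, η) ∈ θ := by
    intro ξ η
    rw [← Submodule.add_mem_iff_left θ (hsub η)]
    simp
  let g : Submodule ℂ (P.space × P.space) :=
    θ.comap (LinearMap.prodMap P.space.subtype P.space.subtype)
  have hgmem : ∀ q, q ∈ g ↔ ((q.1 : 𝔥), (q.2 : 𝔥)) ∈ θ := fun q => Iff.rfl
  have hg : g.toLinearPMap.graph = g := by
    refine Submodule.toLinearPMap_graph_eq g ?_
    rintro ⟨a, b⟩ hab h0
    have h1 : a = 0 := h0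
    rw [hgmem, h1] at hab
    have h2 : (b : 𝔥) ∈ M := hab
    have h3 : (b : 𝔥) ∈ Mᗮ := hP ▸ b.2
    have h4 : (b : 𝔥) = 0 := inner_self_eq_zero.1 (h3 _ h2)
    exact Subtype.ext h4
  have hgs : IsSelfAdjoint g.toLinearPMap := by
    rw [isSelfAdjoint_iff_isSelfAdjointRelation, hg]
    rintro ⟨a, b⟩
    constructor
    · rintro h ⟨a', b'⟩ h'
      exact hθ.inner_eq h h'
    · intro h
      rw [hgmem, hθ]
      rintro ⟨ξ, η⟩ hr
      have h1 := h (⟨ξ, hfst _ hr⟩, P.onto η) ((hproj ξ η).2 hr)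
      rw [P.inner_onto_right] at h1
      exact h1
  let x : PairBundle 𝔥 := ⟨P, g.toLinearPMap, hgs⟩
  refine ⟨x, ?_⟩
  ext ⟨ξ, η⟩
  have hx : (ξ, η) ∈ x.relation ↔ ∃ a : P.space, (a, P.onto η) ∈ g ∧ (a : 𝔥) = ξ := by
    rw [← hg]
    exact mem_relation
  rw [hx]
  constructor
  · rintro ⟨a, h, rfl⟩
    exact (hproj _ _).1 h
  · intro h
    exact ⟨⟨ξ, hfst _ h⟩, (hproj _ _).2 h, rfl⟩

end PairBundle

end Bundle

namespace TraceSetup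

variable {H 𝔥 : Type*}
  [NormedAddCommGroup H] [InnerProductSpace ℂ H] [CompleteSpace H]
  [NormedAddCommGroup 𝔥] [InnerProductSpace ℂ 𝔥] [CompleteSpace 𝔥]
  {D : TraceSetup H 𝔥} {z w : ℂ} {Γ : ℂ → 𝔥 →L[ℂ] 𝔥}

/-! ### The family `Γ̂` -/

variable (D) in
/-- The bounded operator `τ (G(w) - G(z)) = (z - w) G(w̄)* G(z)`. -/
def traceGSub (z w : ℂ) : 𝔥 →L[ℂ] 𝔥 := (z - w) • ((D.G (conj w)).adjoint ∘L D.G z)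

theorem exists_traceGSub_eq (hz : z ∈ resolventSetOf D.A) (hw : w ∈ resolventSetOf D.A) (ξ : 𝔥) :
    ∃ φ : D.A.domain, (φ : H) = D.G w ξ - D.G z ξ ∧ D.traceGSub z w ξ = D.τ φ := by
  obtain ⟨φ, h1, -, h3⟩ := exists_G_sub hz hw ξ
  refine ⟨-φ, ?_, ?_⟩
  · rw [Submodule.coe_neg, h1]; abel
  · rw [map_neg, h3, traceGSub, _root_.smul_apply, ContinuousLinearMap.comp_apply]
    module

theorem traceGSub_add (hz : z ∈ resolventSetOf D.A) (hw : w ∈ resolventSetOf D.A)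
    {v : ℂ} (hv : v ∈ resolventSetOf D.A) :
    D.traceGSub z w + D.traceGSub w v = D.traceGSub z v := by
  ext ξ
  obtain ⟨φ, h1, h1'⟩ := exists_traceGSub_eq hz hw ξ
  obtain ⟨χ, h2, h2'⟩ := exists_traceGSub_eq hw hv ξ
  obtain ⟨ψ, h3, h3'⟩ := exists_traceGSub_eq hz hv ξ
  have : ψ = φ + χ := Subtype.ext (by rw [Submodule.coe_add, h1, h2, h3]; abel)
  rw [add_apply, h1', h2', h3', this, map_add]

/-- The adjoint is minus the same expression at `(w̄, z̄)`, and the cocycle rule makes it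
antisymmetric in its two points. -/
theorem traceGSub_adjoint (hz : z ∈ resolventSetOf D.A) (hw : w ∈ resolventSetOf D.A) :
    (D.traceGSub z w).adjoint = D.traceGSub (conj z) (conj w) := by
  have h0 : D.traceGSub (conj z) (conj z) = 0 := by simp [traceGSub]
  have h1 := traceGSub_add (conj_mem hz) (conj_mem hw) (conj_mem hz)
  rw [h0] at h1
  rw [eq_neg_of_add_eq_zero_left h1, traceGSub, traceGSub, map_smulₛₗ,
    ContinuousLinearMap.adjoint_comp, ContinuousLinearMap.adjoint_adjoint, Complex.conj_conj,
    ← neg_smul, map_sub, neg_sub]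

variable (D) in
/-- The family `Γ̂(z) = τ ((G(i) + G(-i)) / 2 - G(z))`. -/
def gammaHat (z : ℂ) : 𝔥 →L[ℂ] 𝔥 := (1 / 2 : ℂ) • (D.traceGSub z I + D.traceGSub z (-I))

variable (D) in
theorem isGammaHat_gammaHat : D.IsGammaHat D.gammaHat := by
  intro z hz ζ
  obtain ⟨φ, h1, h1'⟩ := exists_traceGSub_eq hz I_mem ζ
  obtain ⟨χ, h2, h2'⟩ := exists_traceGSub_eq hz neg_I_mem ζ
  have h : (1 / 2 : ℂ) • (D.G I ζ + D.G (-I) ζ) - D.G z ζ =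
      (((1 / 2 : ℂ) • (φ + χ) : D.A.domain) : H) := by
    rw [Submodule.coe_smul, Submodule.coe_add, h1, h2]
    module
  refine ⟨h ▸ Subtype.coe_prop _, ?_⟩
  rw [gammaHat, _root_.smul_apply, add_apply, h1', h2', ← map_add, ← map_smul]
  exact congrArg D.τ (Subtype.ext h.symm)

-- The difference identity is the cocycle rule. The symmetry under adjoints needs the average over
-- `±i`, a pair that conjugation swaps.
variable (D) in
theorem isGammaFamily_gammaHat : D.IsGammaFamily D.gammaHat where
  sub_eq z hz w hw := by
    rw [gammaHat, gammaHat, ← traceGSub_add hz hw I_mem, ← traceGSub_add hz hw neg_I_mem]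
    change _ = D.traceGSub z w
    module
  adjoint_eq z hz := by
    rw [gammaHat, gammaHat, map_smulₛₗ, map_add, traceGSub_adjoint hz I_mem,
      traceGSub_adjoint hz neg_I_mem, map_neg, Complex.conj_I, neg_neg, add_comm]
    congr 1
    simp [map_ofNat]

/-! ### The operators `A_{Π,Θ}` -/

theorem mem_Z_of_im_ne_zero (hΓ : D.IsGammaFamily Γ) (x : PairBundle 𝔥) (hz : z.im ≠ 0) :
    z ∈ D.Z Γ x := by
  have hzA : z ∈ resolventSetOf D.A := mem_resolventSetOf_of_im_ne_zero D.selfAdjoint hz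
  refine ⟨hzA, zero_mem_resolventSetOf_iff.2 ?_⟩
  obtain ⟨c, hc, hG⟩ := exists_le_norm_G hzA
  refine exists_isBoundedInverse_vadd (isSelfAdjoint_iff_isSelfAdjointRelation.1 x.2.2)
    -- The constant comes from `Im ⟨a, Γ(z)a⟩ = Im z ‖G(z)a‖²` and `c‖a‖ ≤ ‖G(z)a‖`.
    (x.1.compress (Γ z)) (c := |z.im| * c ^ 2) (by positivity) fun a => ?_
  have h1 : inner ℂ a (x.1.compress (Γ z) a) = inner ℂ (a : 𝔥) (Γ z a) :=
    x.1.inner_onto_right a _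
  have h2 : (inner ℂ (a : 𝔥) (Γ z a)).im = z.im * ‖D.G z a‖ ^ 2 := by
    have h3 := congrArg Complex.im (inner_gamma_sub hΓ hzA (a : 𝔥) a)
    have h4 : inner ℂ (D.G z a) (D.G z a) = ((‖D.G z a‖ ^ 2 : ℝ) : ℂ) := by
      rw [inner_self_eq_norm_sq_to_K]; norm_cast
    rw [← inner_conj_symm, h4, Complex.im_mul_ofReal] at h3
    simp only [Complex.sub_im, Complex.conj_im] at h3
    linarith
  rw [h1, h2, abs_mul, abs_of_nonneg (sq_nonneg ‖D.G z a‖), mul_assoc, ← mul_pow]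
  gcongr
  exact hG a

/-- For `ξ` in the range of `Π`, `Γ_{Π,Θ}(z)ξ = Πτφ` reads `Θξ = Π(τφ - Γ(z)ξ)`: the boundary values
of `φ + G(z)ξ` lie in the relation of `(Π, Θ)`. -/
theorem extensionGraph_eq {x : PairBundle 𝔥} (hz : z ∈ D.Z Γ x) :
    D.extensionGraph Γ x z = D.boundaryRestriction Γ z x.relation := by
  have hR := isBoundedInverse_boundedInverse (zero_mem_resolventSetOf_iff.1 hz.2)
  ext q
  rw [mem_boundaryRestriction]
  constructor
  · rintro ⟨φ, h1, h2⟩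
    set a := boundedInverse (D.gammaPair Γ x z) (x.1.onto (D.τ φ)) with ha
    obtain ⟨h, h'⟩ := (hR a _).1 ha.symm
    have h3 : x.2.1 ⟨a, h⟩ = x.1.onto (D.τ φ - Γ z a) := by
      rw [map_sub, ← h']
      exact (add_sub_cancel_left (x.1.compress (Γ z) a) (x.2.1 ⟨a, h⟩)).symm
    have h4 : q.1 = (φ : H) + D.G z a := h1
    refine ⟨(φ, (a : 𝔥)), ?_, ?_⟩
    · rw [boundaryValue_apply, PairBundle.mk_coe_mem_relation, ← h3]
      exact x.2.1.mem_graph ⟨a, h⟩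
    · rw [defectPair_apply]
      refine Prod.ext h4.symm ?_
      have h5 : q.2 = z • q.1 - (-D.A φ + z • (φ : H)) := by rw [← h2]; abel
      simp only [h5, h4, smul_add]
      abel
  · rintro ⟨⟨φ, ξ⟩, h, rfl⟩
    obtain ⟨a, h1, h2⟩ := PairBundle.mem_relation.1 h
    rw [boundaryValue_apply] at h1 h2
    dsimp only at h1 h2
    subst h2
    obtain ⟨b, h3, h4⟩ := (LinearPMap.mem_graph_iff _).1 h1
    dsimp only at h3 h4
    have h5 : boundedInverse (D.gammaPair Γ x z) (x.1.onto (D.τ φ)) = a := by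
      refine (hR _ _).2 ⟨h3 ▸ b.2, ?_⟩
      subst h3
      change x.1.onto (Γ z (b : x.1.space)) + x.2.1 b = _
      rw [h4, map_sub]
      abel
    refine ⟨φ, ?_, ?_⟩
    · change _ = (φ : H) + D.G z (boundedInverse (D.gammaPair Γ x z) (x.1.onto (D.τ φ)))
      rw [h5, defectPair_apply]
    · rw [defectPair_apply]
      simp only [smul_add]
      abel

/-- `toLinearPMap` returns the given graph only when that graph is single-valued, which holds here
because the relation is self-adjoint with domain containing `N`. -/
theorem graph_extension_eq_boundaryRestriction (hΓ : D.IsGammaFamily Γ) (x : PairBundle 𝔥)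
    (hz : z ∈ resolventSetOf D.A) :
    (D.extension Γ x).graph = D.boundaryRestriction Γ z x.relation := by
  have h1 : D.extensionGraph Γ x I = D.boundaryRestriction Γ I x.relation :=
    extensionGraph_eq (mem_Z_of_im_ne_zero hΓ x (by simp))
  have hsa := isSelfAdjointRelation_boundaryRestriction hΓ (I_mem (D := D))
    x.isSelfAdjointRelation_relation
  rw [extension, h1, Submodule.toLinearPMap_graph_eq, boundaryRestriction_eq hΓ I_mem hz]
  intro q hq h0
  refine hsa.snd_eq_zero_of_dense D.dense_N (fun v hv => ?_) hq h0
  obtain ⟨φ, hφ, rfl⟩ := D.mem_N.1 hv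
  exact ⟨_, mk_mem_boundaryRestriction _ hφ⟩

/-! ### Classification of the extensions and their domains -/

theorem S_le_iff {B : H →ₗ.[ℂ] H} :
    D.S ≤ B ↔ ∀ φ : D.A.domain, D.τ φ = 0 → ((φ : H), D.A φ) ∈ B.graph := by
  rw [← LinearPMap.le_graph_iff]
  have hmem : ∀ q, q ∈ D.S.graph ↔ ∃ φ : D.A.domain, D.τ φ = 0 ∧ ((φ : H), D.A φ) = q := by
    intro q
    rw [LinearPMap.mem_graph_iff']
    constructor
    · rintro ⟨⟨v, hv⟩, rfl⟩
      obtain ⟨φ, h1, h2⟩ := D.mem_N.1 (Submodule.mem_inf.1 hv).1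
      exact ⟨φ, h1, Prod.ext h2 (LinearPMap.domRestrict_apply h2.symm).symm⟩
    · rintro ⟨φ, h1, rfl⟩
      refine ⟨⟨φ, Submodule.mem_inf.2 ⟨D.mem_N.2 ⟨φ, h1, rfl⟩, φ.2⟩⟩, Prod.ext rfl ?_⟩
      exact LinearPMap.domRestrict_apply rfl
  constructor
  · intro h φ hφ
    exact h ((hmem _).2 ⟨φ, hφ, rfl⟩)
  · intro h q hq
    obtain ⟨φ, h1, rfl⟩ := (hmem q).1 hq
    exact h φ h1

theorem isSelfAdjointExtension_extension (hΓ : D.IsGammaFamily Γ) (x : PairBundle 𝔥) :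
    D.IsSelfAdjointExtension (D.extension Γ x) := by
  refine ⟨?_, ?_⟩
  · rw [isSelfAdjoint_iff_isSelfAdjointRelation,
      graph_extension_eq_boundaryRestriction hΓ x I_mem]
    exact isSelfAdjointRelation_boundaryRestriction hΓ I_mem x.isSelfAdjointRelation_relation
  · rw [S_le_iff, graph_extension_eq_boundaryRestriction hΓ x I_mem]
    exact fun φ hφ => mk_mem_boundaryRestriction _ hφ

theorem exists_extension_eq (hΓ : D.IsGammaFamily Γ) {B : H →ₗ.[ℂ] H}
    (hB : D.IsSelfAdjointExtension B) : ∃ x, D.extension Γ x = B := by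
  have hsa := isSelfAdjoint_iff_isSelfAdjointRelation.1 hB.1
  obtain ⟨θ, hθ⟩ := exists_boundaryRestriction_eq Γ (I_mem (D := D)) hsa (S_le_iff.1 hB.2)
  rw [← hθ] at hsa
  obtain ⟨x, rfl⟩ := PairBundle.exists_relation_eq
    (isSelfAdjointRelation_of_boundaryRestriction hΓ I_mem hsa)
  exact ⟨x, LinearPMap.eq_of_eq_graph
    ((graph_extension_eq_boundaryRestriction hΓ x I_mem).trans hθ)⟩

theorem extension_injective (hΓ : D.IsGammaFamily Γ) : Function.Injective (D.extension Γ) := by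
  intro x y h
  apply PairBundle.relation_injective
  apply boundaryRestriction_injective (Γ := Γ) (I_mem (D := D))
  rw [← graph_extension_eq_boundaryRestriction hΓ x I_mem, h,
    graph_extension_eq_boundaryRestriction hΓ y I_mem]

theorem mem_extension_domain_iff (hΓ : D.IsGammaFamily Γ) (x : PairBundle 𝔥) (φ : D.A.domain) :
    (φ : H) ∈ (D.extension Γ x).domain ↔ x.1.1 (D.τ φ) = 0 := by
  rw [LinearPMap.mem_domain_iff, graph_extension_eq_boundaryRestriction hΓ x I_mem]
  simp only [mem_boundaryRestriction]
  constructor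
  · rintro ⟨y, ⟨χ, ξ⟩, h1, h2⟩
    have h3 : (χ : H) + D.G I ξ = φ := congrArg Prod.fst h2
    have h4 : ξ = 0 := by
      -- `G(i)ξ = φ - χ` lies in `D(A)`, so the first boundary value vanishes.
      refine eq_zero_of_G_mem (D := D) I_mem ?_
      rw [← sub_eq_of_eq_add' h3.symm]
      exact sub_mem φ.2 χ.2
    subst h4
    have h5 : χ = φ := Subtype.ext (by simpa using h3)
    subst h5
    rw [boundaryValue_apply, PairBundle.mk_zero_mem_relation, map_zero, sub_zero] at h1
    exact h1
  · intro h
    refine ⟨D.A φ, (φ, 0), ?_, by simp [defectPair_apply]⟩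
    rw [boundaryValue_apply, PairBundle.mk_zero_mem_relation, map_zero, sub_zero]
    exact h

theorem isRelativelyPrime_extension_iff (hΓ : D.IsGammaFamily Γ) (x : PairBundle 𝔥) :
    x.proj = OrthProj.id ↔ D.IsRelativelyPrime (D.extension Γ x) := by
  rw [PairBundle.proj, OrthProj.eq_id_iff, IsRelativelyPrime]
  constructor
  · intro h
    ext v
    rw [Submodule.mem_inf, D.mem_N]
    constructor
    · rintro ⟨h1, h2⟩
      exact ⟨⟨v, h2⟩, h _ ((mem_extension_domain_iff hΓ x ⟨v, h2⟩).1 h1), rfl⟩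
    · rintro ⟨φ, h1, rfl⟩
      exact ⟨(mem_extension_domain_iff hΓ x φ).2 (by rw [h1, map_zero]), φ.2⟩
  · intro h η hη
    obtain ⟨φ, rfl⟩ := D.surjective η
    have h1 : (φ : H) ∈ D.N := h ▸ ⟨(mem_extension_domain_iff hΓ x φ).2 hη, φ.2⟩
    obtain ⟨χ, h2, h3⟩ := D.mem_N.1 h1
    rwa [Subtype.ext h3] at h2

end TraceSetup

end

theorem corollary3p2 {H 𝔥 : Type*}
    [NormedAddCommGroup H] [InnerProductSpace ℂ H] [CompleteSpace H]
    [NormedAddCommGroup 𝔥] [InnerProductSpace ℂ 𝔥] [CompleteSpace 𝔥]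
    (D : TraceSetup H 𝔥) :
    -- the class of families `Γ` is not void: it contains the family `Γ̂`
    (∃ Γ, D.IsGammaHat Γ ∧ D.IsGammaFamily Γ) ∧
    ∀ Γ : ℂ → 𝔥 →L[ℂ] 𝔥, D.IsGammaFamily Γ →
      -- the operators `A_{Π,Θ}` are well defined, independently of `z ∈ Z_{Π,Θ} ⊇ ℂ ∖ ℝ`
      (∀ x : PairBundle 𝔥, (∀ z : ℂ, z.im ≠ 0 → z ∈ D.Z Γ x) ∧
        ∀ z ∈ D.Z Γ x, (D.extension Γ x).graph = D.extensionGraph Γ x z) ∧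
      -- they are exactly the self-adjoint extensions of `S`, parametrised by the bundle
      Set.range (D.extension Γ) = {B | D.IsSelfAdjointExtension B} ∧
      Function.Injective (D.extension Γ) ∧
      -- the fibre over `1` parametrises exactly the relatively prime extensions
      D.extension Γ '' (PairBundle.proj ⁻¹' {OrthProj.id}) =
        {B | D.IsSelfAdjointExtension B ∧ D.IsRelativelyPrime B} ∧
      (∀ x : PairBundle 𝔥,
        x.proj = OrthProj.id ↔ (D.extension Γ x).domain ⊓ D.A.domain = D.N) := by

  refine ⟨⟨D.gammaHat, D.isGammaHat_gammaHat, D.isGammaFamily_gammaHat⟩, fun Γ hΓ => ?_⟩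
  refine ⟨fun x => ⟨fun z hz => TraceSetup.mem_Z_of_im_ne_zero hΓ x hz, fun z hz => ?_⟩, ?_,
    TraceSetup.extension_injective hΓ, ?_, fun x => D.isRelativelyPrime_extension_iff hΓ x⟩
  · rw [TraceSetup.extensionGraph_eq hz, D.graph_extension_eq_boundaryRestriction hΓ x hz.1]
  · ext B
    constructor
    · rintro ⟨x, rfl⟩
      exact TraceSetup.isSelfAdjointExtension_extension hΓ x
    · exact fun hB => TraceSetup.exists_extension_eq hΓ hB
  · ext B
    constructor
    · rintro ⟨x, hx, rfl⟩
      exact ⟨TraceSetup.isSelfAdjointExtension_extension hΓ x,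
        (TraceSetup.isRelativelyPrime_extension_iff hΓ x).1 hx⟩
    · rintro ⟨hB, hp⟩
      obtain ⟨x, rfl⟩ := TraceSetup.exists_extension_eq hΓ hB
      exact ⟨x, (TraceSetup.isRelativelyPrime_extension_iff hΓ x).2 hp, rfl⟩
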